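/- Let $|\cdot|$ be the Euclidean norm on $\mathbb R^d$, let $x_0\in\mathbb R^d$, and write $\operatorname{dist}(A,B)=\sup_{a\in A}\inf_{b\in B}|a-b|$, $\|A\|=\sup_{a\in A}|a|$, and $B_C(0)$ for the closed ball of radius $C$ around $0$. Let $f:[0,T]\times\mathbb R^d\to\mathbb R^d$ be continuous, let $l_f:[0,T]\to\mathbb R$ be continuous, and suppose $\langle f(t,x)-f(t,x'),x-x'\rangle\le l_f(t)|x-x'|^2$ for all $t\in[0,T]$, $x,x'\in\mathbb R^d$. Let $M$ map $[0,T]\times\mathbb R^d$ into the nonempty convex compact subsets of $\mathbb R^d$, continuously with respect to the Hausdorff metric, and let $L_M:[0,T]\to[0,\infty)$ be continuous such that $M(t,\cdot)$ is Lipschitz with constant $L_M(t)$ in the Hausdorff metric for every $t\in[0,T]$. Let $0=t_0<t_1<\dots<t_N=T$ and $h_n:=t_{n+1}-t_n$, with $l_f(t_{n+1})h_n<1$ for $n=0,\dots,N-1$. A solution of the differential inclusion is an absolutely continuous $x:[0,T]\to\mathbb R^d$ with $x(0)=x_0$ and $\dot x(t)\in f(t,x(t))+M(t,x(t))$ for almost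 every $t\in[0,T]$. A trajectory of the parameterized semi-implicit Euler scheme is a sequence $y_0,\dots,y_N$ in $\mathbb R^d$ with $y_0=x_0$ and $y_{n+1}\in y_n+h_nf(t_{n+1},y_{n+1})+h_nM(t_n,y_n)$ for $n=0,\dots,N-1$. Then there is a constant $C>0$ such that every solution and every trajectory is contained in $B_C(0)$. For every such $C$, put \begin{align*} \tau_f(\delta)&=\sup\{|f(t,x)-f(t',x)|: t,t'\in[0,T],\ |t-t'|\le\delta,\ x\in B_C(0)\},\\ \chi_f(\delta)&=\sup\{|f(t,x)-f(t,x')|: t\in[0,T],\ x,x'\in B_C(0),\ |x-x'|\le\delta\},\\ \tau_M(\delta)&=\sup\{\operatorname{dist}(M(t,x),M(t',x)): t,t'\in[0,T],\ |t-t'|\le\delta,\ x\in B_C(0)\},\\ P&=\max_{[0,T]\times B_C(0)}|f|+\max_{[0,T]\times B_C(0)}\|M\|,\\ \Gamma(h,t)&=\tau_f(h)+\chi_f(Ph)+\tau_M(h)+L_M(t)Ph. \end{align*} Then for every solution $x(\cdot)$ there exists a trajectory $\{y_n\}_{n=0}^N$ such that $$|x(t_n)-y_n|\le\sum_{k=0}^{n-1}\exp\Big(\sum_{j=k}^{n-1}\frac{l_f(t_{j+1})h_j}{1-l_f(t_{j+1})h_j}+\sum_{j=k+1}^{n-1}L_M(t_j)h_j\Big)\,h_k\,\Gamma(h_k,t_k)\qquad\text{for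 }n=0,\dots,N.$$ -/

import Mathlib

open Set MeasureTheory Finset

noncomputable section

namespace SemiImplicitEuler

/-- The state space `ℝ^d` with the Euclidean norm. -/
abbrev E (d : ℕ) : Type := EuclideanSpace ℝ (Fin d)

/-- A map `g : ℝ^d → ℝ^d` is one-sided Lipschitz (OSL) with constant `l ∈ ℝ`. -/
def IsOSL {d : ℕ} (l : ℝ) (g : E d → E d) : Prop :=
  ∀ x x' : E d, inner ℝ (g x - g x') (x - x') ≤ l * ‖x - x'‖ ^ 2

/-- Assumption on the single-valued part: `f` is jointly continuous on `[0,T] × ℝ^d`, `l_f` is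
continuous on `[0,T]` and `f(t,·)` is OSL with constant `l_f(t)`. -/
def AssumptionA1 {d : ℕ} (T : ℝ) (f : ℝ → E d → E d) (lf : ℝ → ℝ) : Prop :=
  ContinuousOn (fun p : ℝ × E d => f p.1 p.2) (Icc 0 T ×ˢ univ) ∧
  ContinuousOn lf (Icc 0 T) ∧
  ∀ t ∈ Icc 0 T, IsOSL (lf t) (f t)

/-- Assumption on the set-valued part: `M` has nonempty compact convex values (`ConvexBody`, whose
distance is the Hausdorff distance), it is jointly continuous on `[0,T] × ℝ^d`, `L_M ≥ 0` is
continuous on `[0,T]` and `M(t,·)` is Lipschitz with constant `L_M(t)`. -/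
def AssumptionA2 {d : ℕ} (T : ℝ) (M : ℝ → E d → ConvexBody (E d)) (LM : ℝ → ℝ) : Prop :=
  ContinuousOn (fun p : ℝ × E d => M p.1 p.2) (Icc 0 T ×ˢ univ) ∧
  ContinuousOn LM (Icc 0 T) ∧
  (∀ t ∈ Icc 0 T, 0 ≤ LM t) ∧
  ∀ t ∈ Icc 0 T, ∀ x x' : E d,
    Metric.hausdorffDist (M t x : Set (E d)) (M t x' : Set (E d)) ≤ LM t * ‖x - x'‖

/-- The right-hand side `F(t,x) = f(t,x) + M(t,x)`. -/
def rhs {d : ℕ} (f : ℝ → E d → E d) (M : ℝ → E d → ConvexBody (E d)) (t : ℝ) (x : E d) :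
    Set (E d) :=
  {v | ∃ m ∈ M t x, v = f t x + m}

/-- `x` solves `x'(t) ∈ F(t,x(t))` on `[0,T]`, `x(0) = x₀`: it is absolutely continuous on `[0,T]`
and satisfies the inclusion for almost every `t ∈ [0,T]`. -/
def IsSolution {d : ℕ} (T : ℝ) (f : ℝ → E d → E d) (M : ℝ → E d → ConvexBody (E d)) (x₀ : E d)
    (x : ℝ → E d) : Prop :=
  AbsolutelyContinuousOnInterval x 0 T ∧ x 0 = x₀ ∧
  ∀ᵐ t ∂(volume.restrict (Icc 0 T)), ∃ v ∈ rhs f M t (x t), HasDerivWithinAt x v (Icc 0 T) t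

/-- `0 = t_0 < t_1 < ... < t_N = T` (values `t n` with `n > N` are irrelevant). -/
def IsGrid (T : ℝ) (N : ℕ) (t : ℕ → ℝ) : Prop :=
  t 0 = 0 ∧ t N = T ∧ ∀ n < N, t n < t (n + 1)

/-- The step-size `h_n = t_{n+1} - t_n`. -/
def step (t : ℕ → ℝ) (n : ℕ) : ℝ := t (n + 1) - t n

/-- Step-size condition `l_f(t_{n+1}) h_n < 1` for `n = 0, ..., N-1`. -/
def AssumptionA3 (lf : ℝ → ℝ) (N : ℕ) (t : ℕ → ℝ) : Prop :=
  ∀ n < N, lf (t (n + 1)) * step t n < 1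

/-- One step of the parameterized semi-implicit Euler scheme,
`Φ(t,x;h) = {z : z ∈ x + h f(t+h,z) + h M(t,x)}`. -/
def Phi {d : ℕ} (f : ℝ → E d → E d) (M : ℝ → E d → ConvexBody (E d)) (t : ℝ) (x : E d) (h : ℝ) :
    Set (E d) :=
  {z | ∃ m ∈ M t x, z = x + h • f (t + h) z + h • m}

/-- `y_0, ..., y_N` is a trajectory of the scheme `Φ` on the grid `t_0, ..., t_N` starting at `x₀`
(values `y n` with `n > N` are irrelevant). -/
def IsTrajectory {d : ℕ} (f : ℝ → E d → E d) (M : ℝ → E d → ConvexBody (E d)) (N : ℕ)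
    (t : ℕ → ℝ) (x₀ : E d) (y : ℕ → E d) : Prop :=
  y 0 = x₀ ∧ ∀ n < N, y (n + 1) ∈ Phi f M (t n) (y n) (step t n)

/-- All solutions of the inclusion on `[0,T]` and all trajectories of the scheme on the given grid,
both starting at `x₀`, are contained in the closed ball `B_C(0)`. -/
def BoundsAll {d : ℕ} (T : ℝ) (f : ℝ → E d → E d) (M : ℝ → E d → ConvexBody (E d)) (N : ℕ)
    (t : ℕ → ℝ) (x₀ : E d) (C : ℝ) : Prop :=
  (∀ x : ℝ → E d, IsSolution T f M x₀ x → ∀ s ∈ Icc 0 T, x s ∈ Metric.closedBall (0 : E d) C) ∧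
  (∀ y : ℕ → E d, IsTrajectory f M N t x₀ y → ∀ n ≤ N, y n ∈ Metric.closedBall (0 : E d) C)

/-- The one-sided Hausdorff distance `dist(A,B) = sup_{a ∈ A} inf_{b ∈ B} |a - b|`. -/
def excess {d : ℕ} (A B : Set (E d)) : ℝ := sSup ((fun a => Metric.infDist a B) '' A)

/-- The maximal norm `‖A‖ = sup_{a ∈ A} |a|`. -/
def setNorm {d : ℕ} (A : Set (E d)) : ℝ := sSup ((fun a => ‖a‖) '' A)

/-- The modulus of continuity of `f` in time, on `[0,T] × B_C(0)`. -/
def tauf {d : ℕ} (T : ℝ) (f : ℝ → E d → E d) (C δ : ℝ) : ℝ :=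
  sSup {r | ∃ t ∈ Icc 0 T, ∃ t' ∈ Icc 0 T, ∃ x ∈ Metric.closedBall (0 : E d) C,
    |t - t'| ≤ δ ∧ r = ‖f t x - f t' x‖}

/-- The modulus of continuity of `f` in space, on `[0,T] × B_C(0)`. -/
def chif {d : ℕ} (T : ℝ) (f : ℝ → E d → E d) (C δ : ℝ) : ℝ :=
  sSup {r | ∃ t ∈ Icc 0 T, ∃ x ∈ Metric.closedBall (0 : E d) C,
    ∃ x' ∈ Metric.closedBall (0 : E d) C, ‖x - x'‖ ≤ δ ∧ r = ‖f t x - f t x'‖}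

/-- The modulus of continuity of `M` in time, on `[0,T] × B_C(0)`. -/
def tauM {d : ℕ} (T : ℝ) (M : ℝ → E d → ConvexBody (E d)) (C δ : ℝ) : ℝ :=
  sSup {r | ∃ t ∈ Icc 0 T, ∃ t' ∈ Icc 0 T, ∃ x ∈ Metric.closedBall (0 : E d) C,
    |t - t'| ≤ δ ∧ r = excess (M t x : Set (E d)) (M t' x : Set (E d))}

/-- The velocity bound `P = max |f| + max ‖M‖`, the maxima being over `[0,T] × B_C(0)`. -/
def velBound {d : ℕ} (T : ℝ) (f : ℝ → E d → E d) (M : ℝ → E d → ConvexBody (E d)) (C : ℝ) : ℝ :=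
  sSup {r | ∃ t ∈ Icc 0 T, ∃ x ∈ Metric.closedBall (0 : E d) C, r = ‖f t x‖} +
  sSup {r | ∃ t ∈ Icc 0 T, ∃ x ∈ Metric.closedBall (0 : E d) C, r = setNorm (M t x : Set (E d))}

/-- The error term `Γ(h,t) = τ_f(h) + χ_f(P h) + τ_M(h) + L_M(t) P h`. -/
def Gam {d : ℕ} (T : ℝ) (f : ℝ → E d → E d) (M : ℝ → E d → ConvexBody (E d)) (LM : ℝ → ℝ)
    (C h t : ℝ) : ℝ :=
  tauf T f C h + chif T f C (velBound T f M C * h) + tauM T M C h + LM t * velBound T f M C * h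

end SemiImplicitEuler

end

open SemiImplicitEuler

/-! Fix a step of length h and a point p. While the solution x runs over this step, all its
velocities lie in the closed convex set B(f(t_{n+1}, x(t_{n+1})), ρ) + M(t_n, p) with ρ = Γ + L_M
|x(t_n) - p|, hence so does its mean velocity. Thus x itself performs a semi-implicit step with some
m ∈ M(t_n, p), up to an error hρ, and no measurable selection is needed
(`IsSolution.exists_consistent_selection`).

Take p = y_n and solve the implicit equation with this same m. The one-sided Lipschitz condition
makes z ↦ z - h f(t_{n+1}, z) strongly monotone with modulus 1 - q > 0, q = l_f h. It is therefore
onto (`surjective_of_strongly_monotone`), and its inverse expands distances by at most 1/(1 - q) = 1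
+ q/(1 - q) ≤ exp(q/(1 - q)) (`IsOSL.resolvent_le`). The resulting recursion for the errors unrolls
to the claim (`discrete_gronwall_exp`). -/

/-! ### Monotone maps: variational inequalities and surjectivity. -/

/-- A finite system of Minty inequalities for a monotone map is solvable in every compact convex
set that contains the nodes. -/
theorem exists_minty_finset {V : Type*} [NormedAddCommGroup V] [InnerProductSpace ℝ V]
    {g : V → V} (hg : ∀ x y, 0 ≤ inner ℝ (g x - g y) (x - y)) {K : Set V} (hK : IsCompact K)
    (hconv : Convex ℝ K) (hne : K.Nonempty) (u : Finset V) (hu : ∀ x ∈ u, x ∈ K) :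
    ∃ z ∈ K, ∀ x ∈ u, 0 ≤ inner ℝ (g x) (x - z) := by
  classical
  -- `Ψ` is affine, so `Ψ '' K` is compact and convex. If it misses the nonnegative orthant, a
  -- separating functional yields nonnegative weights on the nodes, and their barycentre contradicts
  -- monotonicity.
  let Ψ : V → (u → ℝ) := fun z i => inner ℝ (g i) (i - z)
  have hΨc : Continuous Ψ := by fun_prop
  have hA : IsCompact (Ψ '' K) := hK.image hΨc
  have hAconv : Convex ℝ (Ψ '' K) := by
    rintro _ ⟨x, hx, rfl⟩ _ ⟨y, hy, rfl⟩ a b ha hb hab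
    refine ⟨a • x + b • y, hconv hx hy ha hb hab, ?_⟩
    ext i
    simp only [Ψ, inner_sub_right, inner_add_right, inner_smul_right, Pi.add_apply,
      Pi.smul_apply, smul_eq_mul]
    linear_combination (-inner ℝ (g i) (i : V)) * hab
  by_contra! hcon
  have hdisj : Disjoint (Ψ '' K) (Ici 0) := by
    rw [Set.disjoint_left]
    rintro _ ⟨z, hz, rfl⟩ h0
    obtain ⟨x, hx, hlt⟩ := hcon z hz
    exact absurd (h0 ⟨x, hx⟩) (not_le.2 hlt)
  obtain ⟨φ, a, b, hφa, hab, hφb⟩ :=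
    geometric_hahn_banach_compact_closed hAconv hA (convex_Ici 0) isClosed_Ici hdisj
  have hb0 : b < 0 := by simpa using hφb 0 (Set.mem_Ici.2 le_rfl)
  let w : u → ℝ := fun i => φ (Pi.single i 1)
  have hφ : ∀ v, φ v = ∑ i, w i * v i := by
    intro v
    conv_lhs => rw [← Finset.univ_sum_single v]
    rw [map_sum]
    refine Finset.sum_congr rfl fun i _ => ?_
    have : Pi.single i (v i) = v i • (Pi.single i 1 : u → ℝ) := by
      rw [← Pi.single_smul, smul_eq_mul, mul_one]
    rw [this, map_smul, smul_eq_mul, mul_comm]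
  have hw : ∀ i, 0 ≤ w i := by
    intro i
    by_contra! hi
    -- This multiple of the basis vector lies in the orthant, yet `φ` takes exactly the value `b` on
    -- it.
    have h1 := hφb ((b / w i) • Pi.single i 1) (by
      rw [Set.mem_Ici]
      exact smul_nonneg (div_nonneg_of_nonpos hb0.le hi.le) (Pi.single_nonneg.2 zero_le_one))
    rw [map_smul, smul_eq_mul] at h1
    change b < b / w i * w i at h1
    rw [div_mul_cancel₀ _ hi.ne] at h1
    exact lt_irrefl _ h1
  have hneg : ∀ z ∈ K, ∑ i, w i * inner ℝ (g i) (i - z) < 0 := by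
    intro z hz
    have := hφa _ ⟨z, hz, rfl⟩
    rw [hφ] at this
    exact this.trans (hab.trans hb0)
  set W := ∑ i, w i with hW
  have hWpos : 0 < W := by
    refine (Finset.sum_nonneg fun i _ => hw i).lt_of_ne fun h => ?_
    obtain ⟨z, hz⟩ := hne
    have h0 := (Finset.sum_eq_zero_iff_of_nonneg fun i _ => hw i).1 h.symm
    have := hneg z hz
    rw [Finset.sum_eq_zero fun i hi => by rw [h0 i hi, zero_mul]] at this
    exact lt_irrefl _ this
  have hz : ∑ j, (W⁻¹ * w j) • (j : V) ∈ K :=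
    hconv.sum_mem (fun i _ => mul_nonneg (inv_nonneg.2 hWpos.le) (hw i))
      (by rw [← Finset.mul_sum, ← hW, inv_mul_cancel₀ hWpos.ne']) fun i _ => hu i i.2
  have hlt := hneg _ hz
  have hexp : ∀ i : u, inner ℝ (g i) (i - ∑ j, (W⁻¹ * w j) • (j : V))
      = ∑ j, W⁻¹ * w j * inner ℝ (g i) (i - j : V) := by
    intro i
    have : (i : V) - ∑ j, (W⁻¹ * w j) • (j : V) = ∑ j, (W⁻¹ * w j) • ((i : V) - j) := by
      simp only [smul_sub, Finset.sum_sub_distrib, ← Finset.sum_smul, ← Finset.mul_sum, ← hW,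
        inv_mul_cancel₀ hWpos.ne', one_smul]
    rw [this, inner_sum]
    simp only [inner_smul_right]
  simp only [hexp, Finset.mul_sum] at hlt
  -- Adding the double sum to its transpose pairs the terms (i, j) and (j, i) into ⟨g i - g j, i -
  -- j⟩ ≥ 0.
  have hswap := Finset.sum_comm (s := (Finset.univ : Finset u)) (t := Finset.univ)
    (f := fun i j => w i * (W⁻¹ * w j * inner ℝ (g i) (i - j : V)))
  have hsum : 0 ≤ ∑ i : u, ∑ j : u, (w i * (W⁻¹ * w j * inner ℝ (g i) (i - j : V))
      + w j * (W⁻¹ * w i * inner ℝ (g j) (j - i : V))) := by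
    refine Finset.sum_nonneg fun i _ => Finset.sum_nonneg fun j _ => ?_
    have h := hg i j
    have : w i * (W⁻¹ * w j * inner ℝ (g i) (i - j : V))
      + w j * (W⁻¹ * w i * inner ℝ (g j) (j - i : V))
        = w i * w j * W⁻¹ * inner ℝ (g i - g j) (i - j : V) := by
      rw [← neg_sub (i : V) j, inner_neg_right, inner_sub_left]; ring
    rw [this]
    exact mul_nonneg (mul_nonneg (mul_nonneg (hw i) (hw j)) (inv_nonneg.2 hWpos.le)) h
  simp only [Finset.sum_add_distrib] at hsum
  linarith

/-- The variational inequality of a continuous monotone map over a compact convex set. -/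
theorem exists_variational_inequality {V : Type*} [NormedAddCommGroup V] [InnerProductSpace ℝ V]
    {g : V → V} (hc : Continuous g) (hg : ∀ x y, 0 ≤ inner ℝ (g x - g y) (x - y)) {K : Set V}
    (hK : IsCompact K) (hconv : Convex ℝ K) (hne : K.Nonempty) :
    ∃ z ∈ K, ∀ x ∈ K, 0 ≤ inner ℝ (g z) (x - z) := by
  classical
  obtain ⟨z, hz, hzt⟩ := hK.inter_iInter_nonempty
    (fun x : K => {z | 0 ≤ inner ℝ (g x) ((x : V) - z)})
    (fun x => isClosed_le continuous_const (by fun_prop)) (fun u => by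
      obtain ⟨z, hz, h⟩ := exists_minty_finset hg hK hconv hne (u.image Subtype.val)
        (by simp +contextual)
      refine ⟨z, hz, ?_⟩
      simp only [Set.mem_iInter]
      exact fun i hi => h i (Finset.mem_image_of_mem _ hi))
  refine ⟨z, hz, fun x hx => ?_⟩
  -- Minty's trick: test at points of the segment from z to x, divide by s, and let s → 0 to move
  -- the argument of `g` from the test point to z.
  have hseg : ∀ s : ℝ, s ∈ Ioc (0 : ℝ) 1 → 0 ≤ inner ℝ (g (z + s • (x - z))) (x - z) := by
    intro s hs
    have hmem : z + s • (x - z) ∈ K := hconv.add_smul_sub_mem hz hx ⟨hs.1.le, hs.2⟩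
    have h : 0 ≤ inner ℝ (g (z + s • (x - z))) (z + s • (x - z) - z) :=
      Set.mem_iInter.1 hzt ⟨_, hmem⟩
    rw [add_sub_cancel_left, inner_smul_right] at h
    exact nonneg_of_mul_nonneg_right h hs.1
  have hlim : Filter.Tendsto (fun s : ℝ => inner ℝ (g (z + s • (x - z))) (x - z))
      (nhdsWithin 0 (Ioi 0)) (nhds (inner ℝ (g z) (x - z))) := by
    have : Continuous fun s : ℝ => inner ℝ (g (z + s • (x - z))) (x - z) := by fun_prop
    simpa using (this.tendsto 0).mono_left nhdsWithin_le_nhds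
  exact ge_of_tendsto hlim (Filter.mem_of_superset
    (Ioc_mem_nhdsGT (zero_lt_one (α := ℝ))) hseg)

/-- A continuous strongly monotone map of a finite-dimensional inner product space is onto. -/
theorem surjective_of_strongly_monotone {V : Type*} [NormedAddCommGroup V]
    [InnerProductSpace ℝ V] [FiniteDimensional ℝ V] {g : V → V} (hc : Continuous g) {c : ℝ}
    (hcpos : 0 < c) (hg : ∀ x y, c * ‖x - y‖ ^ 2 ≤ inner ℝ (g x - g y) (x - y)) :
    Function.Surjective g := by
  intro b
  have := FiniteDimensional.proper_real V
  -- Strong monotonicity bounds the solution of the variational inequality by ‖b - g 0‖ / c. The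
  -- extra 1 puts it in the interior of the ball.
  set R : ℝ := ‖b - g 0‖ / c + 1 with hR
  have hRpos : 0 < R := by positivity
  obtain ⟨z, hz, hvi⟩ := exists_variational_inequality (g := fun x => g x - b) (by fun_prop)
    (fun x y => by
      rw [sub_sub_sub_cancel_right]
      exact le_trans (by positivity) (hg x y))
    (isCompact_closedBall (0 : V) R) (convex_closedBall _ _) ⟨0, by simp [hRpos.le]⟩
  have hzR : ‖z‖ < R := by
    have h0 := hvi 0 (by simp [hRpos.le])
    have h1 := hg z 0
    rw [zero_sub, inner_neg_right] at h0
    rw [sub_zero] at h1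
    have h2 : inner ℝ (g z - g 0) z = inner ℝ (g z - b) z + inner ℝ (b - g 0) z := by
      rw [← inner_add_left, sub_add_sub_cancel]
    have h3 := real_inner_le_norm (b - g 0) z
    have h4 : ‖z‖ ≤ ‖b - g 0‖ / c := by
      rw [le_div_iff₀ hcpos]
      rcases (norm_nonneg z).eq_or_lt with h | h
      · rw [← h]; simp
      · nlinarith
    linarith
  refine ⟨z, ?_⟩
  by_contra hne
  have hpos : 0 < ‖g z - b‖ := norm_pos_iff.2 (sub_ne_zero.2 hne)
  have hs : 0 < (R - ‖z‖) / ‖g z - b‖ := div_pos (by linarith) hpos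
  -- Being interior, z leaves room to test against the direction opposite to the residual.
  have h := hvi (z - ((R - ‖z‖) / ‖g z - b‖) • (g z - b)) (by
    rw [mem_closedBall_zero_iff]
    refine (norm_sub_le _ _).trans ?_
    rw [norm_smul, Real.norm_of_nonneg hs.le, div_mul_cancel₀ _ hpos.ne']
    linarith)
  rw [sub_sub_cancel_left, inner_neg_right, inner_smul_right, real_inner_self_eq_norm_sq] at h
  have : 0 < (R - ‖z‖) / ‖g z - b‖ * ‖g z - b‖ ^ 2 := by positivity
  linarith

/-! ### Absolutely continuous curves: mean values and Gronwall. -/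

/-- Transfers absolute continuity from a curve to its image under a functional and to its squared
norm. -/
theorem AbsolutelyContinuousOnInterval.of_dist_le {X Y : Type*} [PseudoMetricSpace X]
    [PseudoMetricSpace Y] {x : ℝ → X} {y : ℝ → Y} {a b : ℝ} (K : ℝ)
    (hx : AbsolutelyContinuousOnInterval x a b)
    (h : ∀ s ∈ uIcc a b, ∀ t ∈ uIcc a b, dist (y s) (y t) ≤ K * dist (x s) (x t)) :
    AbsolutelyContinuousOnInterval y a b := by
  rw [absolutelyContinuousOnInterval_iff] at hx ⊢
  intro ε hε
  obtain ⟨δ, hδ, H⟩ := hx (ε / (|K| + 1)) (by positivity)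
  refine ⟨δ, hδ, fun I hI hlen => ?_⟩
  have hlt := H I hI hlen
  rw [lt_div_iff₀ (by positivity), mul_comm, Finset.mul_sum] at hlt
  refine lt_of_le_of_lt (Finset.sum_le_sum fun i hi => ?_) hlt
  refine (h _ (hI.1 i hi).1 _ (hI.1 i hi).2).trans ?_
  exact mul_le_mul_of_nonneg_right ((le_abs_self K).trans (by linarith)) dist_nonneg

/-- Mean value inequality for absolutely continuous real functions. -/
theorem AbsolutelyContinuousOnInterval.sub_le_of_ae_hasDerivWithinAt {φ : ℝ → ℝ} {a b c : ℝ}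
    (hab : a ≤ b) (hφ : AbsolutelyContinuousOnInterval φ a b)
    (h : ∀ᵐ t ∂volume.restrict (Icc a b), ∃ v ≤ c, HasDerivWithinAt φ v (Icc a b) t) :
    φ b - φ a ≤ (b - a) * c := by
  rw [← hφ.integral_deriv_eq_sub]
  have hderiv : deriv φ ≤ᵐ[volume.restrict (Icc a b)] fun _ => c := by
    have hIoo : ∀ᵐ t ∂volume.restrict (Icc a b), t ∈ Ioo a b := by
      rw [← restrict_Ioo_eq_restrict_Icc]
      exact ae_restrict_mem measurableSet_Ioo
    filter_upwards [h, hIoo] with t ⟨v, hv, hd⟩ ht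
    rw [(hd.hasDerivAt (Icc_mem_nhds ht.1 ht.2)).deriv]
    exact hv
  calc ∫ t in a..b, deriv φ t ≤ ∫ _ in a..b, c :=
        intervalIntegral.integral_mono_ae_restrict hab hφ.intervalIntegrable_deriv
          intervalIntegrable_const hderiv
    _ = (b - a) * c := by simp

/-- Mean value theorem for absolutely continuous functions and closed convex sets of velocities. -/
theorem AbsolutelyContinuousOnInterval.slope_mem_of_ae_hasDerivWithinAt {V : Type*}
    [NormedAddCommGroup V] [NormedSpace ℝ V] {x : ℝ → V} {a b : ℝ} (hab : a < b)
    (hx : AbsolutelyContinuousOnInterval x a b) {K : Set V} (hK : Convex ℝ K) (hKc : IsClosed K)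
    (h : ∀ᵐ t ∂volume.restrict (Icc a b), ∃ v ∈ K, HasDerivWithinAt x v (Icc a b) t) :
    (b - a)⁻¹ • (x b - x a) ∈ K := by
  by_contra hnot
  obtain ⟨φ, u, hu, hlt⟩ := geometric_hahn_banach_closed_point hK hKc hnot
  have hac : AbsolutelyContinuousOnInterval (fun t => φ (x t)) a b := by
    refine AbsolutelyContinuousOnInterval.of_dist_le ‖φ‖ hx fun s _ t _ => ?_
    rw [dist_eq_norm, dist_eq_norm, ← map_sub]
    exact φ.le_opNorm _
  have := hac.sub_le_of_ae_hasDerivWithinAt (c := u) hab.le (by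
    filter_upwards [h] with t ⟨v, hv, hd⟩
    exact ⟨φ v, (hu v hv).le, φ.hasFDerivAt.comp_hasDerivWithinAt t hd⟩)
  rw [map_smul, map_sub, smul_eq_mul, inv_mul_eq_div, lt_div_iff₀ (sub_pos.2 hab)] at hlt
  linarith

/-- Gronwall bound for the squared norm of an absolutely continuous curve. -/
theorem AbsolutelyContinuousOnInterval.sq_norm_le_of_inner_deriv_le {V : Type*}
    [NormedAddCommGroup V] [InnerProductSpace ℝ V] {x : ℝ → V} {T A : ℝ} (hA : 0 ≤ A)
    (hx : AbsolutelyContinuousOnInterval x 0 T)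
    (h : ∀ᵐ t ∂volume.restrict (Icc 0 T), ∃ v, inner ℝ (x t) v ≤ A * (‖x t‖ ^ 2 + 1) ∧
      HasDerivWithinAt x v (Icc 0 T) t) {s : ℝ} (hs : s ∈ Icc 0 T) :
    ‖x s‖ ^ 2 ≤ (‖x 0‖ ^ 2 + 1) * Real.exp (2 * A * T) := by
  have hsub : Icc 0 s ⊆ Icc 0 T := Icc_subset_Icc_right hs.2
  have hxs : AbsolutelyContinuousOnInterval x 0 s := hx.mono (by
    rwa [uIcc_of_le hs.1, uIcc_of_le (hs.1.trans hs.2)])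
  obtain ⟨D, hD⟩ := hxs.exists_bound
  have hsq : AbsolutelyContinuousOnInterval (fun t => ‖x t‖ ^ 2 + 1) 0 s := by
    refine AbsolutelyContinuousOnInterval.of_dist_le (2 * D) hxs fun p hp q hq => ?_
    rw [Real.dist_eq, dist_eq_norm,
      show ‖x p‖ ^ 2 + 1 - (‖x q‖ ^ 2 + 1) = (‖x p‖ + ‖x q‖) * (‖x p‖ - ‖x q‖) by ring, abs_mul,
      abs_of_nonneg (by positivity)]
    exact mul_le_mul (by linarith [hD p hp, hD q hq]) (abs_norm_sub_norm_le _ _) (abs_nonneg _)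
      (by linarith [hD p hp, norm_nonneg (x p)])
  have hexp : AbsolutelyContinuousOnInterval (fun t => Real.exp (-(2 * A * t))) 0 s :=
    ContDiffOn.absolutelyContinuousOnInterval (by fun_prop)
  -- With the integrating factor exp(-2At), the function ‖x‖² + 1 has a product of nonpositive
  -- derivative.
  have hmono := (hsq.fun_mul hexp).sub_le_of_ae_hasDerivWithinAt (c := 0) hs.1 (by
    filter_upwards [ae_restrict_of_ae_restrict_of_subset hsub h] with t ⟨v, hv, hd⟩
    have hd1 := ((hd.mono hsub).norm_sq.add_const 1).mul
      (((hasDerivAt_id t).const_mul (2 * A)).neg.exp.hasDerivWithinAt (s := Icc 0 s))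
    refine ⟨_, ?_, hd1⟩
    simp only [id_eq, mul_one, Pi.neg_apply]
    nlinarith [mul_le_mul_of_nonneg_right hv (Real.exp_pos (-(2 * A * t))).le])
  simp only [mul_zero, neg_zero, Real.exp_zero, mul_one] at hmono
  have hle : Real.exp (2 * A * s) ≤ Real.exp (2 * A * T) :=
    Real.exp_le_exp.2 (mul_le_mul_of_nonneg_left hs.2 (by positivity))
  have hmul : Real.exp (-(2 * A * s)) * Real.exp (2 * A * s) = 1 := by
    rw [← Real.exp_add, neg_add_cancel, Real.exp_zero]
  have h2 : ‖x s‖ ^ 2 + 1 ≤ (‖x 0‖ ^ 2 + 1) * Real.exp (2 * A * s) := by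
    calc ‖x s‖ ^ 2 + 1 = (‖x s‖ ^ 2 + 1) * Real.exp (-(2 * A * s)) * Real.exp (2 * A * s) := by
          rw [mul_assoc, hmul, mul_one]
      _ ≤ _ := mul_le_mul_of_nonneg_right (by linarith) (Real.exp_pos _).le
  have h3 : (‖x 0‖ ^ 2 + 1) * Real.exp (2 * A * s) ≤ (‖x 0‖ ^ 2 + 1) * Real.exp (2 * A * T) :=
    mul_le_mul_of_nonneg_left hle (by positivity)
  linarith

/-! ### Growth estimates, the implicit step and a priori bounds. -/

namespace SemiImplicitEuler

variable {d : ℕ}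

theorem infDist_le_dist_convexBody {K L : ConvexBody (E d)} {m : E d} (hm : m ∈ K) :
    Metric.infDist m (L : Set (E d)) ≤ dist K L :=
  Metric.infDist_le_hausdorffDist_of_mem hm ConvexBody.hausdorffEDist_ne_top

theorem exists_norm_sub_le_dist {K L : ConvexBody (E d)} {m : E d} (hm : m ∈ K) :
    ∃ m' ∈ L, ‖m - m'‖ ≤ dist K L := by
  obtain ⟨m', hm', h⟩ := L.isCompact.exists_infDist_eq_dist L.nonempty m
  exact ⟨m', hm', by rw [← dist_eq_norm, ← h]; exact infDist_le_dist_convexBody hm⟩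

theorem norm_le_dist_zero {K : ConvexBody (E d)} {m : E d} (hm : m ∈ K) : ‖m‖ ≤ dist K 0 := by
  obtain ⟨m', hm', h⟩ := exists_norm_sub_le_dist (L := 0) hm
  have : m' = 0 := by
    have h' : m' ∈ ((0 : ConvexBody (E d)) : Set (E d)) := hm'
    rwa [ConvexBody.coe_zero, Set.mem_zero] at h'
  rwa [this, sub_zero] at h

variable {T : ℝ} {f : ℝ → E d → E d} {lf : ℝ → ℝ} {M : ℝ → E d → ConvexBody (E d)} {LM : ℝ → ℝ}

theorem AssumptionA1.exists_bound (hf : AssumptionA1 T f lf) (R : ℝ) :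
    ∃ B, 0 ≤ B ∧ ∀ t ∈ Icc 0 T, ∀ x ∈ Metric.closedBall (0 : E d) R, ‖f t x‖ ≤ B := by
  obtain ⟨B, hB⟩ :=
    (isCompact_Icc.prod (isCompact_closedBall (0 : E d) R)).exists_bound_of_continuousOn
    (hf.1.mono (Set.prod_mono_right (subset_univ _)))
  exact ⟨|B|, abs_nonneg B, fun t ht x hx => (hB (t, x) ⟨ht, hx⟩).trans (le_abs_self B)⟩

theorem AssumptionA2.exists_dist_bound (hM : AssumptionA2 T M LM) (R : ℝ) :
    ∃ B, 0 ≤ B ∧ ∀ t ∈ Icc 0 T, ∀ x ∈ Metric.closedBall (0 : E d) R, dist (M t x) 0 ≤ B := by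
  have hc : ContinuousOn (fun p : ℝ × E d => dist (M p.1 p.2) 0)
      (Icc 0 T ×ˢ Metric.closedBall 0 R) :=
    (continuous_id.dist continuous_const).comp_continuousOn
      (hM.1.mono (Set.prod_mono_right (subset_univ _)))
  obtain ⟨B, hB⟩ :=
    (isCompact_Icc.prod (isCompact_closedBall (0 : E d) R)).exists_bound_of_continuousOn hc
  exact ⟨|B|, abs_nonneg B, fun t ht x hx =>
    (le_abs_self _).trans ((hB (t, x) ⟨ht, hx⟩).trans (le_abs_self B))⟩

theorem AssumptionA2.dist_le (hM : AssumptionA2 T M LM) {t : ℝ} (ht : t ∈ Icc 0 T) (x y : E d) :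
    dist (M t x) (M t y) ≤ LM t * ‖x - y‖ := by
  rw [← ConvexBody.hausdorffDist_coe]
  exact hM.2.2.2 t ht x y

theorem AssumptionA2.exists_growth (hM : AssumptionA2 T M LM) :
    ∃ B, 0 ≤ B ∧ ∀ t ∈ Icc 0 T, ∀ x, ∀ m ∈ M t x, ‖m‖ ≤ B + LM t * ‖x‖ := by
  obtain ⟨B, hB, h⟩ := hM.exists_dist_bound 0
  refine ⟨B, hB, fun t ht x m hm => (norm_le_dist_zero hm).trans ?_⟩
  have h1 := dist_triangle (M t x) (M t 0) 0
  have h2 := hM.dist_le ht x 0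
  rw [sub_zero] at h2
  linarith [h t ht 0 (by simp)]

theorem AssumptionA1.continuous (hf : AssumptionA1 T f lf) {t : ℝ} (ht : t ∈ Icc 0 T) :
    Continuous (f t) :=
  hf.1.comp_continuous (f := fun x : E d => (t, x)) (by fun_prop) fun _ => ⟨ht, trivial⟩

/-- The implicit Euler map `z ↦ z - h g(z)` of an OSL map is strongly monotone. -/
theorem IsOSL.sub_smul_strongly_monotone {l h : ℝ} {g : E d → E d} (hg : IsOSL l g) (hh : 0 ≤ h)
    (z w : E d) :
    (1 - l * h) * ‖z - w‖ ^ 2 ≤ inner ℝ ((z - h • g z) - (w - h • g w)) (z - w) := by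
  have h1 : (z - h • g z) - (w - h • g w) = (z - w) - h • (g z - g w) := by
    rw [smul_sub]; abel
  rw [h1, inner_sub_left, real_inner_self_eq_norm_sq, real_inner_smul_left]
  nlinarith [mul_le_mul_of_nonneg_left (hg z w) hh]

theorem IsOSL.resolvent_le {l h : ℝ} {g : E d → E d} (hg : IsOSL l g) (hh : 0 ≤ h) (z w : E d) :
    (1 - l * h) * ‖z - w‖ ≤ ‖(z - h • g z) - (w - h • g w)‖ := by
  rcases (norm_nonneg (z - w)).eq_or_lt with h0 | h0
  · rw [← h0, mul_zero]; exact norm_nonneg _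
  · have h1 := (hg.sub_smul_strongly_monotone hh z w).trans (real_inner_le_norm _ _)
    refine le_of_mul_le_mul_right ?_ h0
    linarith [h1, show (1 - l * h) * ‖z - w‖ ^ 2 = (1 - l * h) * ‖z - w‖ * ‖z - w‖ by ring]

theorem AssumptionA1.exists_implicit_step (hf : AssumptionA1 T f lf) {t h : ℝ} (ht : t ∈ Icc 0 T)
    (hh : 0 ≤ h) (hlt : lf t * h < 1) (p : E d) : ∃ z, z = p + h • f t z := by
  have hc := hf.continuous ht
  obtain ⟨z, hz⟩ := surjective_of_strongly_monotone (g := fun z => z - h • f t z) (by fun_prop)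
    (sub_pos.2 hlt) (fun z w => (hf.2.2 t ht).sub_smul_strongly_monotone hh z w) p
  exact ⟨z, sub_eq_iff_eq_add.1 hz⟩

variable {N : ℕ} {t : ℕ → ℝ} {x₀ : E d}

theorem IsGrid.le (ht : IsGrid T N t) {m n : ℕ} (hmn : m ≤ n) (hn : n ≤ N) : t m ≤ t n := by
  induction n, hmn using Nat.le_induction with
  | base => exact le_rfl
  | succ k hk ih => exact (ih (by omega)).trans (ht.2.2 k (by omega)).le

theorem IsGrid.mem (ht : IsGrid T N t) {n : ℕ} (hn : n ≤ N) : t n ∈ Icc 0 T := by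
  constructor
  · rw [← ht.1]; exact ht.le (Nat.zero_le n) hn
  · rw [← ht.2.1]; exact ht.le hn le_rfl

theorem IsGrid.step_pos (ht : IsGrid T N t) {n : ℕ} (hn : n < N) : 0 < step t n :=
  sub_pos.2 (ht.2.2 n hn)

theorem add_step (t : ℕ → ℝ) (n : ℕ) : t n + step t n = t (n + 1) := add_sub_cancel _ _

/-- The bound must be uniform over all trajectories, so the induction carries `R` outside the
quantifier over `y`. -/
theorem exists_trajectory_bound (hf : AssumptionA1 T f lf) (hM : AssumptionA2 T M LM)
    (ht : IsGrid T N t) (hstep : AssumptionA3 lf N t) {n : ℕ} (hn : n ≤ N) :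
    ∃ R, ∀ y, IsTrajectory f M N t x₀ y → ∀ k ≤ n, ‖y k‖ ≤ R := by
  induction n with
  | zero =>
    refine ⟨‖x₀‖, fun y hy k hk => ?_⟩
    rw [Nat.le_zero.1 hk, hy.1]
  | succ n ih =>
    obtain ⟨R, hR⟩ := ih (by omega)
    obtain ⟨B, -, hgrow⟩ := hM.exists_growth
    have htn := ht.mem (n := n) (by omega)
    have htn' := ht.mem hn
    have hh := ht.step_pos (n := n) (by omega)
    have hl := hstep n (by omega)
    have hpos : 0 < 1 - lf (t (n + 1)) * step t n := sub_pos.2 hl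
    set h := step t n
    -- The new bound comes from the resolvent estimate comparing y_{n+1} with 0.
    refine ⟨max R ((R + h * (B + LM (t n) * R) + h * ‖f (t (n + 1)) 0‖)
      / (1 - lf (t (n + 1)) * h)), fun y hy k hk => ?_⟩
    rcases Nat.le_succ_iff.1 hk with hk | rfl
    · exact (hR y hy k hk).trans (le_max_left _ _)
    refine le_trans ?_ (le_max_right _ _)
    rw [le_div_iff₀ hpos, mul_comm]
    obtain ⟨m, hm, hym⟩ := hy.2 n (by omega)
    rw [add_step] at hym
    have hres := (hf.2.2 _ htn').resolvent_le hh.le (y (n + 1)) 0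
    have heq : y (n + 1) - h • f (t (n + 1)) (y (n + 1)) - (0 - h • f (t (n + 1)) 0)
        = y n + h • m + h • f (t (n + 1)) 0 := by
      nth_rw 1 [hym]; abel
    rw [sub_zero, heq] at hres
    refine hres.trans ((norm_add₃_le).trans ?_)
    rw [norm_smul, norm_smul, Real.norm_of_nonneg hh.le]
    have h1 := hR y hy n le_rfl
    have h2 := hgrow _ htn _ m hm
    have h3 := mul_le_mul_of_nonneg_left h1 (hM.2.2.1 _ htn)
    have h4 := mul_le_mul_of_nonneg_left (h2.trans (add_le_add_right h3 B)) hh.le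
    linarith

/-- Testing the velocity with x uses only the one-sided bound on `f` and the linear growth of `M`,
so ⟨x, v⟩ ≤ A(‖x‖² + 1) and Gronwall applies. -/
theorem exists_solution_bound (hf : AssumptionA1 T f lf) (hM : AssumptionA2 T M LM) :
    ∃ R, ∀ x, IsSolution T f M x₀ x → ∀ s ∈ Icc 0 T, ‖x s‖ ≤ R := by
  obtain ⟨B, hB, hgrow⟩ := hM.exists_growth
  obtain ⟨B₁, hB₁, hf0⟩ := hf.exists_bound 0
  obtain ⟨B₂, hlf⟩ := isCompact_Icc.exists_bound_of_continuousOn hf.2.1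
  obtain ⟨B₃, hLM⟩ := isCompact_Icc.exists_bound_of_continuousOn hM.2.1
  set A := |B₂| + B₁ + B + |B₃| with hA
  refine ⟨Real.sqrt ((‖x₀‖ ^ 2 + 1) * Real.exp (2 * A * T)), fun x hx s hs => ?_⟩
  refine Real.le_sqrt_of_sq_le ?_
  rw [← hx.2.1]
  refine hx.1.sq_norm_le_of_inner_deriv_le (by positivity) ?_ hs
  filter_upwards [hx.2.2, ae_restrict_mem measurableSet_Icc] with r ⟨v, ⟨m, hm, hv⟩, hd⟩ hr
  refine ⟨v, ?_, hd⟩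
  have h1 := hf.2.2 r hr (x r) 0
  rw [sub_zero, inner_sub_left] at h1
  have h2 := (real_inner_le_norm (f r 0) (x r)).trans
    (mul_le_mul_of_nonneg_right (hf0 r hr 0 (by simp)) (norm_nonneg _))
  have h3 := (real_inner_le_norm m (x r)).trans
    (mul_le_mul_of_nonneg_right (hgrow r hr _ m hm) (norm_nonneg _))
  have h4 : lf r ≤ |B₂| := (le_abs_self _).trans ((hlf r hr).trans (le_abs_self _))
  have h5 : LM r ≤ |B₃| := (le_abs_self _).trans ((hLM r hr).trans (le_abs_self _))
  have h6 := mul_le_mul_of_nonneg_right h4 (sq_nonneg ‖x r‖)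
  have h7 := mul_le_mul_of_nonneg_right h5 (sq_nonneg ‖x r‖)
  have h8 : ‖x r‖ ≤ ‖x r‖ ^ 2 + 1 := by nlinarith [sq_nonneg (‖x r‖ - 1)]
  have h9 := mul_le_mul_of_nonneg_left h8 (add_nonneg hB₁ hB)
  rw [real_inner_comm, hv, inner_add_left, hA]
  nlinarith [abs_nonneg B₂, abs_nonneg B₃]

theorem exists_boundsAll (hf : AssumptionA1 T f lf) (hM : AssumptionA2 T M LM)
    (ht : IsGrid T N t) (hstep : AssumptionA3 lf N t) :
    ∃ C : ℝ, 0 < C ∧ BoundsAll T f M N t x₀ C := by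
  obtain ⟨R₁, h₁⟩ := exists_solution_bound (x₀ := x₀) hf hM
  obtain ⟨R₂, h₂⟩ := exists_trajectory_bound (x₀ := x₀) hf hM ht hstep le_rfl
  refine ⟨max (max R₁ R₂) 1, by positivity, fun x hx s hs => ?_, fun y hy n hn => ?_⟩
  · rw [mem_closedBall_zero_iff]
    exact (h₁ x hx s hs).trans ((le_max_left _ _).trans (le_max_left _ _))
  · rw [mem_closedBall_zero_iff]
    exact (h₂ y hy n hn).trans ((le_max_right _ _).trans (le_max_left _ _))

end SemiImplicitEuler

/-! ### Moduli of continuity, consistency and the one-step error. -/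

namespace SemiImplicitEuler

variable {d : ℕ} {T : ℝ} {f : ℝ → E d → E d} {lf : ℝ → ℝ} {M : ℝ → E d → ConvexBody (E d)}
  {LM : ℝ → ℝ} {C : ℝ}

/-- A real `sSup` is an upper bound only for a set that is bounded above. Here and in the next
estimates compactness of [0,T] × B_C(0) supplies this. -/
theorem AssumptionA1.norm_sub_le_tauf (hf : AssumptionA1 T f lf) {δ s s' : ℝ} (hs : s ∈ Icc 0 T)
    (hs' : s' ∈ Icc 0 T) {x : E d} (hx : x ∈ Metric.closedBall 0 C) (h : |s - s'| ≤ δ) :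
    ‖f s x - f s' x‖ ≤ tauf T f C δ := by
  obtain ⟨B, -, hB⟩ := hf.exists_bound C
  refine le_csSup ⟨B + B, ?_⟩ ⟨s, hs, s', hs', x, hx, h, rfl⟩
  rintro _ ⟨r, hr, r', hr', z, hz, -, rfl⟩
  exact (norm_sub_le _ _).trans (add_le_add (hB r hr z hz) (hB r' hr' z hz))

theorem AssumptionA1.norm_sub_le_chif (hf : AssumptionA1 T f lf) {δ s : ℝ} (hs : s ∈ Icc 0 T)
    {x x' : E d} (hx : x ∈ Metric.closedBall 0 C) (hx' : x' ∈ Metric.closedBall 0 C)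
    (h : ‖x - x'‖ ≤ δ) : ‖f s x - f s x'‖ ≤ chif T f C δ := by
  obtain ⟨B, -, hB⟩ := hf.exists_bound C
  refine le_csSup ⟨B + B, ?_⟩ ⟨s, hs, x, hx, x', hx', h, rfl⟩
  rintro _ ⟨r, hr, z, hz, z', hz', -, rfl⟩
  exact (norm_sub_le _ _).trans (add_le_add (hB r hr z hz) (hB r hr z' hz'))

theorem infDist_le_excess {K L : ConvexBody (E d)} {m : E d} (hm : m ∈ K) :
    Metric.infDist m (L : Set (E d)) ≤ excess (K : Set (E d)) (L : Set (E d)) := by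
  refine le_csSup ⟨dist K L, ?_⟩ ⟨m, hm, rfl⟩
  rintro _ ⟨a, ha, rfl⟩
  exact infDist_le_dist_convexBody ha

theorem excess_le_dist (K L : ConvexBody (E d)) :
    excess (K : Set (E d)) (L : Set (E d)) ≤ dist K L := by
  refine csSup_le (K.nonempty.image _) ?_
  rintro _ ⟨a, ha, rfl⟩
  exact infDist_le_dist_convexBody ha

theorem AssumptionA2.infDist_le_tauM (hM : AssumptionA2 T M LM) {δ s s' : ℝ} (hs : s ∈ Icc 0 T)
    (hs' : s' ∈ Icc 0 T) {x : E d} (hx : x ∈ Metric.closedBall 0 C) (h : |s - s'| ≤ δ)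
    {m : E d} (hm : m ∈ M s x) :
    Metric.infDist m (M s' x : Set (E d)) ≤ tauM T M C δ := by
  obtain ⟨B, -, hB⟩ := hM.exists_dist_bound C
  refine (infDist_le_excess hm).trans (le_csSup ⟨B + B, ?_⟩ ⟨s, hs, s', hs', x, hx, h, rfl⟩)
  rintro _ ⟨r, hr, r', hr', z, hz, -, rfl⟩
  exact (excess_le_dist _ _).trans
    ((dist_triangle_right _ _ 0).trans (add_le_add (hB r hr z hz) (hB r' hr' z hz)))

theorem norm_le_velBound (hf : AssumptionA1 T f lf) (hM : AssumptionA2 T M LM) {s : ℝ}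
    (hs : s ∈ Icc 0 T) {x : E d} (hx : x ∈ Metric.closedBall 0 C) {v : E d}
    (hv : v ∈ rhs f M s x) : ‖v‖ ≤ velBound T f M C := by
  obtain ⟨m, hm, rfl⟩ := hv
  obtain ⟨B, -, hB⟩ := hf.exists_bound C
  obtain ⟨D, -, hD⟩ := hM.exists_dist_bound C
  refine (norm_add_le _ _).trans (add_le_add (le_csSup ⟨B, ?_⟩ ⟨s, hs, x, hx, rfl⟩)
    (le_trans (le_csSup ⟨D, ?_⟩ ⟨m, hm, rfl⟩ : ‖m‖ ≤ setNorm (M s x : Set (E d)))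
      (le_csSup ⟨D, ?_⟩ ⟨s, hs, x, hx, rfl⟩)))
  · rintro _ ⟨r, hr, z, hz, rfl⟩
    exact hB r hr z hz
  · rintro _ ⟨a, ha, rfl⟩
    exact (norm_le_dist_zero ha).trans (hD s hs x hx)
  · rintro _ ⟨r, hr, z, hz, rfl⟩
    refine csSup_le ((M r z).nonempty.image _) ?_
    rintro _ ⟨a, ha, rfl⟩
    exact (norm_le_dist_zero ha).trans (hD r hr z hz)

variable {x₀ : E d} {x : ℝ → E d}

theorem IsSolution.slope_mem (hx : IsSolution T f M x₀ x) {a b : ℝ} (ha : 0 ≤ a) (hab : a < b)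
    (hb : b ≤ T) {K : Set (E d)} (hK : Convex ℝ K) (hKc : IsClosed K)
    (h : ∀ s ∈ Icc a b, ∀ v ∈ rhs f M s (x s), v ∈ K) : (b - a)⁻¹ • (x b - x a) ∈ K := by
  have hsub : Icc a b ⊆ Icc 0 T := Icc_subset_Icc ha hb
  have hxs : AbsolutelyContinuousOnInterval x a b := hx.1.mono (by
    rwa [uIcc_of_le hab.le, uIcc_of_le (ha.trans (hab.le.trans hb))])
  refine hxs.slope_mem_of_ae_hasDerivWithinAt hab hK hKc ?_
  filter_upwards [ae_restrict_of_ae_restrict_of_subset hsub hx.2.2,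
    ae_restrict_mem measurableSet_Icc] with s ⟨v, hv, hd⟩ hs
  exact ⟨v, h s hs v hv, hd.mono hsub⟩

theorem IsSolution.norm_sub_le (hf : AssumptionA1 T f lf) (hM : AssumptionA2 T M LM)
    (hx : IsSolution T f M x₀ x) (hC : ∀ s ∈ Icc 0 T, x s ∈ Metric.closedBall (0 : E d) C)
    {a b : ℝ} (ha : 0 ≤ a) (hab : a ≤ b) (hb : b ≤ T) :
    ‖x b - x a‖ ≤ velBound T f M C * (b - a) := by
  rcases hab.eq_or_lt with rfl | hab
  · simp
  have h := hx.slope_mem ha hab hb (convex_closedBall (0 : E d) (velBound T f M C))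
    Metric.isClosed_closedBall (fun s hs v hv => mem_closedBall_zero_iff.2
      (norm_le_velBound hf hM ⟨ha.trans hs.1, hs.2.trans hb⟩
        (hC s ⟨ha.trans hs.1, hs.2.trans hb⟩) hv))
  have hpos := sub_pos.2 hab
  rwa [mem_closedBall_zero_iff, norm_smul, norm_inv, Real.norm_of_nonneg hpos.le,
    inv_mul_le_iff₀ hpos, mul_comm] at h

open scoped Pointwise in
/-- Consistency of the scheme: over `[a, b]` a solution follows one semi-implicit step whose
set-valued part is evaluated at an arbitrary point `p`. -/
theorem IsSolution.exists_consistent_selection (hf : AssumptionA1 T f lf)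
    (hM : AssumptionA2 T M LM) (hx : IsSolution T f M x₀ x)
    (hC : ∀ s ∈ Icc 0 T, x s ∈ Metric.closedBall (0 : E d) C)
    {a b : ℝ} (ha : 0 ≤ a) (hab : a < b) (hb : b ≤ T) (p : E d) :
    ∃ m ∈ M a p, ‖x b - (x a + (b - a) • f b (x b) + (b - a) • m)‖
      ≤ (b - a) * (Gam T f M LM C (b - a) a + LM a * ‖x a - p‖) := by
  set h := b - a with hh
  have hpos : 0 < h := sub_pos.2 hab
  have haT : a ∈ Icc 0 T := ⟨ha, hab.le.trans hb⟩
  have hbT : b ∈ Icc 0 T := ⟨ha.trans hab.le, hb⟩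
  set P := velBound T f M C with hP
  have hP0 : 0 ≤ P := nonneg_of_mul_nonneg_left
    ((norm_nonneg _).trans (hx.norm_sub_le hf hM hC ha hab.le hb)) hpos
  set ρ := Gam T f M LM C h a + LM a * ‖x a - p‖ with hρ
  -- Project the set-valued part μ of a velocity onto `M a p`. The remainder pays τ_f and χ_f for
  -- moving `f` to (b, x b), and τ_M and L_M for moving `M` to (a, p).
  have hmem := hx.slope_mem ha hab hb (K := Metric.closedBall (f b (x b)) ρ + (M a p : Set (E d)))
    ((convex_closedBall _ _).add (M a p).convex)
    ((isCompact_closedBall _ _).add (M a p).isCompact).isClosed (by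
      rintro s hs _ ⟨μ, hμ, rfl⟩
      have hsT : s ∈ Icc 0 T := ⟨ha.trans hs.1, hs.2.trans hb⟩
      have hsa : ‖x s - x a‖ ≤ P * h := by
        have h1 := hx.norm_sub_le hf hM hC ha hs.1 hsT.2
        exact h1.trans (mul_le_mul_of_nonneg_left (by linarith [hs.2]) hP0)
      have hsb : ‖x s - x b‖ ≤ P * h := by
        have h2 := hx.norm_sub_le hf hM hC hsT.1 hs.2 hb
        rw [norm_sub_rev]
        exact h2.trans (mul_le_mul_of_nonneg_left (by linarith [hs.1]) hP0)
      obtain ⟨m, hm, hdist⟩ := (M a p).isCompact.exists_infDist_eq_dist (M a p).nonempty μ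
      refine ⟨f s (x s) + μ - m, ?_, m, hm, by simp⟩
      have hf1 : ‖f s (x s) - f b (x s)‖ ≤ tauf T f C h :=
        hf.norm_sub_le_tauf hsT hbT (hC s hsT)
          (by rw [abs_le]; constructor <;> linarith [hs.1, hs.2])
      have hf2 : ‖f b (x s) - f b (x b)‖ ≤ chif T f C (P * h) :=
        hf.norm_sub_le_chif hbT (hC s hsT) (hC b hbT) hsb
      have hM1 : Metric.infDist μ (M a (x s) : Set (E d)) ≤ tauM T M C h :=
        hM.infDist_le_tauM hsT haT (hC s hsT)
          (by rw [abs_le]; constructor <;> linarith [hs.1, hs.2]) hμ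
      have hM2 : dist (M a (x s)) (M a p) ≤ LM a * (P * h + ‖x a - p‖) :=
        (hM.dist_le haT _ _).trans (mul_le_mul_of_nonneg_left
          ((norm_sub_le_norm_sub_add_norm_sub _ (x a) _).trans (by linarith)) (hM.2.2.1 a haT))
      have hM3 : ‖μ - m‖ ≤ Metric.infDist μ (M a (x s) : Set (E d)) + dist (M a (x s)) (M a p) := by
        rw [← dist_eq_norm, ← hdist]
        exact Metric.infDist_le_infDist_add_hausdorffDist ConvexBody.hausdorffEDist_ne_top
      have heq : f s (x s) + μ - m - f b (x b)
          = (f s (x s) - f b (x s)) + (f b (x s) - f b (x b)) + (μ - m) := by abel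
      rw [Metric.mem_closedBall, dist_eq_norm, heq]
      refine (norm_add₃_le).trans ?_
      rw [hρ, Gam, ← hP]
      linarith)
  obtain ⟨c, hc, m, hm, hcm⟩ := hmem
  refine ⟨m, hm, ?_⟩
  have hcm' : x b - x a = h • (c + m) := by
    have hcm2 : c + m = h⁻¹ • (x b - x a) := hcm
    rw [hcm2, smul_inv_smul₀ hpos.ne']
  have heq : x b - (x a + h • f b (x b) + h • m) = h • (c - f b (x b)) := by
    calc x b - (x a + h • f b (x b) + h • m) = (x b - x a) - h • f b (x b) - h • m := by abel
      _ = _ := by rw [hcm', smul_add, smul_sub]; abel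
  rw [heq, norm_smul, Real.norm_of_nonneg hpos.le]
  refine mul_le_mul_of_nonneg_left ?_ hpos.le
  rwa [Metric.mem_closedBall, dist_eq_norm] at hc

variable {N : ℕ} {t : ℕ → ℝ}

/-- One step of the scheme started at `p` stays close to the solution. -/
theorem IsSolution.exists_step (hf : AssumptionA1 T f lf) (hM : AssumptionA2 T M LM)
    (ht : IsGrid T N t) (hstep : AssumptionA3 lf N t) (hx : IsSolution T f M x₀ x)
    (hC : ∀ s ∈ Icc 0 T, x s ∈ Metric.closedBall (0 : E d) C) {n : ℕ} (hn : n < N) (p : E d) :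
    ∃ z ∈ Phi f M (t n) p (step t n),
      ‖x (t (n + 1)) - z‖ ≤
        Real.exp (lf (t (n + 1)) * step t n / (1 - lf (t (n + 1)) * step t n)) *
          (Real.exp (LM (t n) * step t n) * ‖x (t n) - p‖
            + step t n * Gam T f M LM C (step t n) (t n)) := by
  have htn := ht.mem hn.le
  have htn' := ht.mem (n := n + 1) hn
  have hpos := ht.step_pos hn
  obtain ⟨m, hm, hbd⟩ := hx.exists_consistent_selection hf hM hC htn.1 (ht.2.2 n hn) htn'.2 p
  change ‖x (t (n + 1)) - (x (t n) + step t n • f (t (n + 1)) (x (t (n + 1))) + step t n • m)‖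
    ≤ step t n * (Gam T f M LM C (step t n) (t n) + LM (t n) * ‖x (t n) - p‖) at hbd
  obtain ⟨z, hz⟩ := hf.exists_implicit_step htn' hpos.le (hstep n hn) (p + step t n • m)
  refine ⟨z, ⟨m, hm, ?_⟩, ?_⟩
  · rw [add_step, add_right_comm]; exact hz
  have hlt := sub_pos.2 (hstep n hn)
  have hres := (hf.2.2 _ htn').resolvent_le hpos.le (x (t (n + 1))) z
  generalize step t n = h at *
  generalize Gam T f M LM C h (t n) = Γ at *
  have heq : x (t (n + 1)) - h • f (t (n + 1)) (x (t (n + 1))) - (z - h • f (t (n + 1)) z)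
      = (x (t (n + 1)) - (x (t n) + h • f (t (n + 1)) (x (t (n + 1))) + h • m))
        + (x (t n) - p) := by
    nth_rw 1 [hz]; abel
  rw [heq] at hres
  have hres2 := hres.trans ((norm_add_le _ _).trans (add_le_add_left hbd _))
  have hexp1 := Real.add_one_le_exp (LM (t n) * h)
  have hexp2 := Real.add_one_le_exp (lf (t (n + 1)) * h / (1 - lf (t (n + 1)) * h))
  generalize lf (t (n + 1)) * h = q at *
  have h1 : (1 - q) * ‖x (t (n + 1)) - z‖
      ≤ Real.exp (LM (t n) * h) * ‖x (t n) - p‖ + h * Γ := by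
    nlinarith [mul_le_mul_of_nonneg_right hexp1 (norm_nonneg (x (t n) - p))]
  have h2 : q / (1 - q) + 1 = (1 - q)⁻¹ := by field_simp; ring
  rw [h2] at hexp2
  -- The bracket must be nonnegative before its factor 1/(1 - q) may be enlarged to the exponential;
  -- this avoids a separate sign argument for Γ.
  have h0 := (mul_nonneg hlt.le (norm_nonneg (x (t (n + 1)) - z))).trans h1
  calc ‖x (t (n + 1)) - z‖ = (1 - q)⁻¹ * ((1 - q) * ‖x (t (n + 1)) - z‖) :=
        (inv_mul_cancel_left₀ hlt.ne' _).symm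
    _ ≤ (1 - q)⁻¹ * (Real.exp (LM (t n) * h) * ‖x (t n) - p‖ + h * Γ) :=
        mul_le_mul_of_nonneg_left h1 (inv_nonneg.2 hlt.le)
    _ ≤ _ := mul_le_mul_of_nonneg_right hexp2 h0

end SemiImplicitEuler

/-! ### Accumulation of the errors. -/

/-- Discrete Gronwall inequality with exponential growth factors. -/
theorem discrete_gronwall_exp {N : ℕ} {e a b c : ℕ → ℝ} (he0 : e 0 ≤ 0)
    (he : ∀ n < N, e (n + 1) ≤ Real.exp (a n) * (Real.exp (b n) * e n + c n)) {n : ℕ}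
    (hn : n ≤ N) :
    e n ≤ ∑ k ∈ Finset.range n,
      Real.exp ((∑ j ∈ Finset.Ico k n, a j) + ∑ j ∈ Finset.Ico (k + 1) n, b j) * c k := by
  induction n with
  | zero => simpa using he0
  | succ n ih =>
    refine (he n (by omega)).trans ?_
    rw [Finset.sum_range_succ, mul_add]
    -- The newest term k = n carries only `a n`: the implicit solve amplifies the fresh error, while
    -- `b n` acts on the old error alone. Hence the sums start at k and k + 1.
    refine add_le_add ?_ (by simp)
    rw [← mul_assoc, ← Real.exp_add]
    refine (mul_le_mul_of_nonneg_left (ih (by omega)) (Real.exp_pos _).le).trans_eq ?_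
    rw [Finset.mul_sum]
    refine Finset.sum_congr rfl fun k hk => ?_
    have hk' : k + 1 ≤ n := Finset.mem_range.1 hk
    rw [Finset.sum_Ico_succ_top (by omega), Finset.sum_Ico_succ_top hk', ← mul_assoc,
      ← Real.exp_add]
    congr 2
    ring

theorem corollary16 {d : ℕ} (T : ℝ)
    (f : ℝ → E d → E d) (lf : ℝ → ℝ) (M : ℝ → E d → ConvexBody (E d)) (LM : ℝ → ℝ)
    (hf : AssumptionA1 T f lf) (hM : AssumptionA2 T M LM) (x₀ : E d)
    (N : ℕ) (t : ℕ → ℝ) (ht : IsGrid T N t) (hstep : AssumptionA3 lf N t) :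
    (∃ C : ℝ, 0 < C ∧ BoundsAll T f M N t x₀ C) ∧
    ∀ C : ℝ, 0 < C → BoundsAll T f M N t x₀ C →
      ∀ x : ℝ → E d, IsSolution T f M x₀ x →
        ∃ y : ℕ → E d, IsTrajectory f M N t x₀ y ∧
          ∀ n ≤ N, ‖x (t n) - y n‖ ≤
            ∑ k ∈ Finset.range n,
              Real.exp ((∑ j ∈ Finset.Ico k n,
                    lf (t (j + 1)) * step t j / (1 - lf (t (j + 1)) * step t j))
                  + (∑ j ∈ Finset.Ico (k + 1) n, LM (t j) * step t j))
                * step t k * Gam T f M LM C (step t k) (t k) := by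

  refine ⟨exists_boundsAll hf hM ht hstep, fun C _ hC x hx => ?_⟩
  -- The step depends on the current point, so the trajectory is built recursively, each selection
  -- from `M` being made at the `y n` already reached.
  choose! S hS using fun n (hn : n < N) p => hx.exists_step hf hM ht hstep (hC.1 x hx) hn p
  let y : ℕ → E d := fun n => Nat.rec x₀ (fun n p => S n p) n
  refine ⟨y, ⟨rfl, fun n hn => (hS n hn (y n)).1⟩, fun n hn => ?_⟩
  have := discrete_gronwall_exp (e := fun n => ‖x (t n) - y n‖)
    (by simp [y, ht.1, hx.2.1]) (fun n hn => (hS n hn (y n)).2) hn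
  simpa only [mul_assoc] using this
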